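/- Let $p$ be a prime, let $(R,\mathfrak m)$ be a commutative Noetherian local ring of characteristic $p$, and let $R[x,f]$ be the Frobenius skew polynomial ring: the free left $R$-module on $(x^i)_{i\ge 0}$ with multiplication determined by $xr=r^px$. It is a graded ring with $R[x,f]_n=Rx^n$. **Terminology.** Let $H$ be a left $R[x,f]$-module. - $H$ is $x$-torsion-free if $x^nh=0$ with $n\ge 1$ implies $h=0$. The graded annihilator of an $R[x,f]$-submodule $N$ of $H$ is the largest graded two-sided ideal of $R[x,f]$ that annihilates $N$. $\mathcal I(H)$ is the set of ideals $\mathfrak c$ of $R$ such that $\mathfrak cR[x,f]=\bigoplus_n\mathfrak cx^n$ is the graded annihilator of some $R[x,f]$-submodule of $H$. For an ideal $\mathfrak b$ of $R$, $H$ is $\mathfrak b$-testable if, whenever $h\in H$ and $c\in R$ lies in no minimal prime of $R$ and $cx^nh=0$ for all $n\gg0$, then $ax^nh=0$ for all $a\in\mathfrak b$ and $n\ge0$. The height of the ideal $R$ is $\infty$. - For $\mathbb Z$-graded left $R[x,f]$-modules, $G(s)$ is the shift with $G(s)_n=G_{n+s}$, and the graded product of a non-empty family $(H^{(\lambda)})_\lambda$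 is $\prod'_\lambda H^{(\lambda)}=\bigoplus_n\prod_\lambda H^{(\lambda)}_n$, with $x$ acting coordinatewise. - Let $W=\bigoplus_{n\ge b}W_n$ be a graded left $R[x,f]$-module, let $(g_i)_{i\in I}$ be a family of elements of $W_b$ with $I\neq\emptyset$, and let $h\ge1$. Put $V=\bigoplus_{i\in I}R$, $f((r_i))=(r_i^p)$ and $L=\{(r_i)\in V:\sum r_ig_i=0\}$. The $h$-place extension of $W$ by $(g_i)_{i\in I}$ is the graded left $R[x,f]$-module $$V/f^{-h}(L)\oplus\cdots\oplus V/f^{-1}(L)\oplus W_b\oplus W_{b+1}\oplus\cdots$$ with $V/f^{-j}(L)$ in degree $b-j$, where $x$ acts on $W$ as before, $x(v+f^{-j}(L))=f(v)+f^{-(j-1)}(L)$ for $2\le j\le h$, and $x((r_i)+f^{-1}(L))=\sum r_i^pg_i$. The $0$-place extension of $W$ is $W$. **Theorem.** Let $G=\bigoplus_{n\ge0}G_n$ be an $\mathbb N_0$-graded left $R[x,f]$-module such that $G_0$ is $R$-isomorphic to the injective envelope $E_R(R/\mathfrak m)$. Let $M$ be an $R$-module each of whose elements is annihilated by a power of $\mathfrak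 m$. Then there are $\mathbb N_0$-graded left $R[x,f]$-modules $H^{(n)}$ $(n\ge 0)$, where $H^{(n)}$ is an $n$-place extension of the shift by $-n$ of a graded product of copies of $G$ (with $b=n$ in the definition above), and, with $K=\prod'_{n\ge0}H^{(n)}$, there is an injective $R[x,f]$-homomorphism, homogeneous of degree $0$, $$\nu: R[x,f]\otimes_RM=\bigoplus_{i\ge0}(Rx^i\otimes_RM)\longrightarrow K .$$ If, moreover, $G$ is $x$-torsion-free and $\mathcal I(G)$ is finite, then $\mathcal I(G)$ has a smallest member $\mathfrak b$ among its members of positive height, $K$ is $x$-torsion-free with $\mathcal I(K)=\mathcal I(G)$, and $R[x,f]\otimes_RM$ is $\mathfrak b$-testable. -/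

import Mathlib

open scoped TensorProduct DirectSum

universe u v w

/-! ### The Frobenius skew polynomial ring -/

noncomputable section

/-- The action of `(ℕ, +)` on `R` in which `n` acts as the `n`-th iterate of the Frobenius
homomorphism `f : r ↦ r ^ p`. -/
abbrev frobeniusAction (R : Type u) [CommRing R] (p : ℕ) [Fact p.Prime] [CharP R p] :
    MulSemiringAction (Multiplicative ℕ) R :=
  MulSemiringAction.compHom R (powersHom (R →+* R) (frobenius R p))

/-- The Frobenius skew polynomial ring `R[x,f]`: Mathlib's skew polynomials
`∑ rᵢ xⁱ` over `R` with the multiplication determined by `x r = r ^ p x`. -/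
def FrobSkew (R : Type u) [CommRing R] (p : ℕ) [Fact p.Prime] [CharP R p] : Type u :=
  SkewPolynomial R

namespace FrobSkew

variable (R : Type u) [CommRing R] (p : ℕ) [Fact p.Prime] [CharP R p]

instance : Ring (FrobSkew R p) :=
  letI := frobeniusAction R p
  inferInstanceAs (Ring (SkewMonoidAlgebra R (Multiplicative ℕ)))

variable {R}

/-- The inclusion of the coefficient ring `R` in `R[x,f]`. -/
def C : R →+* FrobSkew R p :=
  letI := frobeniusAction R p
  SkewPolynomial.CRingHom

/-- The indeterminate `x`. -/
def X : FrobSkew R p := SkewPolynomial.X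

/-- The coefficient of `x ^ n`. -/
def coeff {p : ℕ} [Fact p.Prime] [CharP R p] (a : FrobSkew R p) (n : ℕ) : R :=
  SkewPolynomial.coeff a n

theorem X_mul_C (r : R) : (X p : FrobSkew R p) * C p r = C p (r ^ p) * X p := by
  let _ := frobeniusAction R p
  have h : (SkewPolynomial.X : SkewPolynomial R) * SkewPolynomial.C r =
      SkewPolynomial.C (r ^ p) * SkewPolynomial.X := by
    rw [← SkewPolynomial.monomial_zero_left, SkewPolynomial.X_mul_monomial,
      ← SkewPolynomial.monomial_zero_left, SkewPolynomial.monomial_mul_X]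
    rfl
  exact h

theorem coeff_C_mul_X_pow (r : R) (n k : ℕ) :
    coeff (C p r * X p ^ n) k = if n = k then r else 0 := by
  let _ := frobeniusAction R p
  have h : SkewPolynomial.coeff
      ((SkewPolynomial.C r : SkewPolynomial R) * SkewPolynomial.X ^ n) k =
        if n = k then r else 0 := by
    rw [SkewPolynomial.C_mul_X_pow_eq_monomial, SkewPolynomial.coeff_monomial]
  exact h

/-- `R[x,f]` as an `R`-module through its *right* multiplication: the scalar `r` sends `a` to
`a r`. (`R` is commutative. Left multiplication by `r ∈ R` is always written `C p r * a`.) -/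
instance rightModule : Module R (FrobSkew R p) where
  smul r a := a * C p r
  one_smul a := by change a * C p 1 = a; simp
  mul_smul r s a := by
    change a * C p (r * s) = a * C p s * C p r
    rw [mul_comm r s, map_mul, mul_assoc]
  smul_zero r := by change 0 * C p r = 0; simp
  smul_add r a b := by change (a + b) * C p r = a * C p r + b * C p r; rw [add_mul]
  add_smul r s a := by change a * C p (r + s) = a * C p r + a * C p s; rw [map_add, mul_add]
  zero_smul a := by change a * C p 0 = 0; simp

theorem right_smul_def (r : R) (a : FrobSkew R p) : r • a = a * C p r := rfl

instance : SMulCommClass R (FrobSkew R p) (FrobSkew R p) where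
  smul_comm r a b := by simp [right_smul_def, mul_assoc]

end FrobSkew

/-- The left `R[x,f]`-module `R[x,f] ⊗_R M`, the tensor product being formed with respect to the
right `R`-module structure on `R[x,f]`. -/
abbrev SkewTensor (R : Type u) [CommRing R] (p : ℕ) [Fact p.Prime] [CharP R p]
    (M : Type v) [AddCommGroup M] [Module R M] : Type max u v :=
  FrobSkew R p ⊗[R] M

/-- The component `Rxⁱ ⊗_R M` of degree `i` of `R[x,f] ⊗_R M`. -/
def SkewTensor.component (R : Type u) [CommRing R] (p : ℕ) [Fact p.Prime] [CharP R p]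
    (M : Type v) [AddCommGroup M] [Module R M] (i : ℕ) : AddSubgroup (SkewTensor R p M) :=
  AddSubgroup.closure
    {t | ∃ (r : R) (m : M), t = (FrobSkew.C p r * FrobSkew.X p ^ i) ⊗ₜ[R] m}

/-! ### Left `R[x,f]`-modules -/

section Modules

variable (R : Type u) [CommRing R] (p : ℕ) [Fact p.Prime] [CharP R p]
  (H : Type v) [AddCommGroup H] [Module (FrobSkew R p) H]

/-- `H` is `x`-torsion-free: an element killed by a power of `x` is `0`. -/
def IsXTorsionFree : Prop :=
  ∀ h : H, (∃ n : ℕ, (FrobSkew.X p : FrobSkew R p) ^ n • h = 0) → h = 0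

/-- A two-sided ideal of `R[x,f]` is graded if it contains the homogeneous components of its
elements. -/
def IsGradedIdeal {R : Type u} [CommRing R] {p : ℕ} [Fact p.Prime] [CharP R p]
    (B : TwoSidedIdeal (FrobSkew R p)) : Prop :=
  ∀ a ∈ B, ∀ n : ℕ, FrobSkew.C p (a.coeff n) * FrobSkew.X p ^ n ∈ B

/-- `B` is the graded annihilator of the submodule `N`: the largest graded two-sided ideal of
`R[x,f]` that annihilates `N`. -/
def IsGradedAnnihilator {R : Type u} [CommRing R] {p : ℕ} [Fact p.Prime] [CharP R p]
    {H : Type v} [AddCommGroup H] [Module (FrobSkew R p) H]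
    (N : Submodule (FrobSkew R p) H) (B : TwoSidedIdeal (FrobSkew R p)) : Prop :=
  IsGreatest {B' : TwoSidedIdeal (FrobSkew R p) |
    IsGradedIdeal B' ∧ ∀ a ∈ B', ∀ h ∈ N, a • h = 0} B

/-- The set `𝓘(H)` of `H`-special `R`-ideals: the ideals `𝔠` of `R` such that
`𝔠R[x,f] = ⨁ₙ 𝔠xⁿ` is the graded annihilator of some `R[x,f]`-submodule of `H`. -/
def specialIdeals : Set (Ideal R) :=
  {c | ∃ (N : Submodule (FrobSkew R p) H) (B : TwoSidedIdeal (FrobSkew R p)),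
    IsGradedAnnihilator N B ∧ ∀ a : FrobSkew R p, a ∈ B ↔ ∀ n : ℕ, a.coeff n ∈ c}

/-- `H` is `a`-testable: whenever `h ∈ H` and `c ∈ R°` (that is, `c` lies in no minimal prime of
`R`) are such that `c xⁿ h = 0` for all `n ≫ 0`, then `a xⁿ h = 0` for all `n ≥ 0`. -/
def IsTestable (a : R) : Prop :=
  ∀ (h : H) (c : R), (∀ P ∈ minimalPrimes R, c ∉ P) →
    (∀ᶠ n : ℕ in Filter.atTop, (FrobSkew.C p c * FrobSkew.X p ^ n) • h = 0) →
    ∀ n : ℕ, (FrobSkew.C p a * FrobSkew.X p ^ n) • h = 0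

/-- `H` is `𝔟`-testable: it is `a`-testable for every `a ∈ 𝔟`. -/
def IsIdealTestable (b : Ideal R) : Prop :=
  ∀ a ∈ b, IsTestable R p H a

end Modules

/-! ### Graded left `R[x,f]`-modules -/

/-- A `ℤ`-graded left `R[x,f]`-module `⨁ₙ Gₙ`, given by its components `Gₙ`, which are
`R`-modules, and the multiplications by `x`, which are additive maps `Gₘ → Gₘ₊₁` with
`x (r g) = r ^ p (x g)`. (A proof of `m + 1 = n` is an argument of `x` so as to avoid casts.) -/
structure GradedSkewModule (R : Type u) [CommRing R] (p : ℕ) where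
  piece : ℤ → Type v
  [addCommGroup : ∀ n, AddCommGroup (piece n)]
  [module : ∀ n, Module R (piece n)]
  x : ∀ {m n : ℤ}, m + 1 = n → piece m →+ piece n
  x_smul : ∀ {m n : ℤ} (h : m + 1 = n) (r : R) (g : piece m), x h (r • g) = r ^ p • x h g

namespace GradedSkewModule

attribute [instance] GradedSkewModule.addCommGroup GradedSkewModule.module

variable {R : Type u} [CommRing R] {p : ℕ}

/-- `G` is `ℕ`-graded: its components of negative degree are zero. -/
def IsNatGraded (G : GradedSkewModule.{u, v} R p) : Prop :=
  ∀ n : ℤ, n < 0 → Subsingleton (G.piece n)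

/-- The underlying module `⨁ₙ Gₙ`. -/
def Total (G : GradedSkewModule.{u, v} R p) : Type v := ⨁ n, G.piece n

namespace Total

variable (G : GradedSkewModule.{u, v} R p)

instance : AddCommGroup G.Total := inferInstanceAs (AddCommGroup (⨁ n, G.piece n))

/-- The inclusion of the component of degree `n`. -/
def of (n : ℤ) : G.piece n →+ G.Total := DirectSum.of G.piece n

/-- Multiplication by `x` on `⨁ₙ Gₙ`. -/
def xEnd : AddMonoid.End G.Total :=
  DirectSum.toAddMonoid (fun n => (of G (n + 1)).comp (G.x rfl))

/-- Multiplication by `r ∈ R` on `⨁ₙ Gₙ`. -/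
def scalarEnd : R →+* AddMonoid.End G.Total :=
  Module.toAddMonoidEnd R (⨁ n, G.piece n)

theorem scalarEnd_of (r : R) (n : ℤ) (g : G.piece n) :
    scalarEnd G r (of G n g) = of G n (r • g) :=
  (DirectSum.of_smul R n r g).symm

theorem xEnd_of {m n : ℤ} (h : m + 1 = n) (g : G.piece m) :
    xEnd G (of G m g) = of G n (G.x h g) := by
  subst h
  exact DirectSum.toAddMonoid_of _ _ _

theorem xEnd_mul_scalarEnd (r : R) :
    xEnd G * scalarEnd G r = scalarEnd G (r ^ p) * xEnd G := by
  refine DirectSum.addHom_ext (β := G.piece) (γ := G.Total) fun n g => ?_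
  change xEnd G (scalarEnd G r (of G n g)) = scalarEnd G (r ^ p) (xEnd G (of G n g))
  rw [scalarEnd_of, xEnd_of G rfl, xEnd_of G rfl, scalarEnd_of, x_smul]

theorem xEnd_pow_mul_scalarEnd (n : ℕ) (r : R) :
    xEnd G ^ n * scalarEnd G r = scalarEnd G (r ^ p ^ n) * xEnd G ^ n := by
  induction n generalizing r with
  | zero => simp
  | succ n ih =>
    rw [pow_succ, mul_assoc, xEnd_mul_scalarEnd, ← mul_assoc, ih, mul_assoc, ← pow_mul,
      ← pow_succ']

variable [Fact p.Prime] [CharP R p]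

/-- The action of `R[x,f]` on `⨁ₙ Gₙ`, as a ring homomorphism. -/
def toEnd : FrobSkew R p →+* AddMonoid.End G.Total :=
  letI := frobeniusAction R p
  SkewMonoidAlgebra.liftNCRingHom (scalarEnd G) (powersHom (AddMonoid.End G.Total) (xEnd G)) (by
    intro r n
    have h : n • r = r ^ p ^ n.toAdd := by
      change (powersHom (R →+* R) (frobenius R p) n) r = _
      rw [powersHom_apply, RingHom.coe_pow, ← coe_iterateFrobenius, iterateFrobenius_def]
    rw [h, powersHom_apply, xEnd_pow_mul_scalarEnd])

/-- The left `R[x,f]`-module structure on `⨁ₙ Gₙ`. -/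
instance : Module (FrobSkew R p) G.Total := Module.compHom _ (toEnd G)

theorem C_smul_of (r : R) (n : ℤ) (g : G.piece n) :
    FrobSkew.C p r • of G n g = of G n (r • g) := by
  let _ := frobeniusAction R p
  have h : toEnd G (FrobSkew.C p r) = scalarEnd G r := by
    refine (SkewMonoidAlgebra.liftNC_single _ _ 1 r).trans ?_
    rw [map_one, mul_one]
    rfl
  change toEnd G (FrobSkew.C p r) (of G n g) = _
  rw [h, scalarEnd_of]

theorem X_smul_of {m n : ℤ} (h : m + 1 = n) (g : G.piece m) :
    (FrobSkew.X p : FrobSkew R p) • of G m g = of G n (G.x h g) := by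
  let _ := frobeniusAction R p
  have h' : toEnd G (FrobSkew.X p) = xEnd G := by
    refine (SkewMonoidAlgebra.liftNC_single _ _ (Multiplicative.ofAdd 1) 1).trans ?_
    change scalarEnd G 1 * xEnd G ^ 1 = xEnd G
    rw [map_one, one_mul, pow_one]
  change toEnd G (FrobSkew.X p) (of G m g) = _
  rw [h', xEnd_of G h]

end Total

/-- The `s`-th shift `G(s)`: its component of degree `n` is `Gₙ₊ₛ`. -/
def shift (G : GradedSkewModule.{u, v} R p) (s : ℤ) : GradedSkewModule.{u, v} R p where
  piece n := G.piece (n + s)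
  x h := G.x (by omega)
  x_smul _ r g := G.x_smul _ r g

/-- The graded product of a family of graded left `R[x,f]`-modules: its component of degree `n`
is the product of the components of degree `n`, and `x` acts coordinatewise. -/
def gradedProduct {Y : Type w} (H : Y → GradedSkewModule.{u, v} R p) :
    GradedSkewModule.{u, max w v} R p where
  piece n := ∀ y, (H y).piece n
  x h := AddMonoidHom.piMap fun y => (H y).x h
  x_smul h r g := funext fun y => (H y).x_smul h r (g y)

section Extension

variable [Fact p.Prime] [CharP R p] {I : Type w}

/-- The Frobenius map `(rᵢ) ↦ (rᵢ ^ p)` on the free `R`-module `V = ⨁_{i ∈ I} R`. -/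
def frobV (R : Type u) [CommRing R] (p : ℕ) [Fact p.Prime] [CharP R p] (I : Type w) :
    (I →₀ R) →ₛₗ[frobenius R p] (I →₀ R) where
  toFun v := v.mapRange (frobenius R p) (map_zero _)
  map_add' v v' := by ext i; simp
  map_smul' r v := by ext i; simp

/-- `f⁻ʲ(K)`, the preimage of the submodule `K` of `V` under the `j`-th iterate of the Frobenius
map of `V`. -/
def frobPreimage (K : Submodule R (I →₀ R)) : ℕ → Submodule R (I →₀ R)
  | 0 => K
  | j + 1 => (frobPreimage K j).comap (frobV R p I)

variable (W : GradedSkewModule.{u, v} R p) (b : ℤ) (g : I → W.piece b) (h : ℕ)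

/-- For `b - h ≤ n < b` this is `f^{-(b-n)}(K)`, where `K = {(rᵢ) ∈ V : ∑ rᵢ gᵢ = 0}`; in all
other degrees it is `V`. -/
def extensionKernel (n : ℤ) : Submodule R (I →₀ R) :=
  if b - h ≤ n ∧ n < b then
    frobPreimage (p := p) (LinearMap.ker (Finsupp.linearCombination R g)) (b - n).toNat
  else ⊤

/-- The semilinear map `V → Wₙ` sending `(rᵢ)` to `∑ rᵢ ^ p gᵢ` if `n = b`, and to `0` if
`n ≠ b`. -/
def extensionEval (n : ℤ) : (I →₀ R) →ₛₗ[frobenius R p] W.piece n :=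
  (Finsupp.linearCombination R fun i => (Pi.single b (g i) : ∀ k, W.piece k) n).comp
    (frobV R p I)

theorem extensionKernel_le_comap {m n : ℤ} (hmn : m + 1 = n) (hm : b - h ≤ m ∧ m < b) :
    extensionKernel W b g h m ≤ (extensionKernel W b g h n).comap (frobV R p I) := by
  unfold extensionKernel
  rw [if_pos hm]
  split_ifs with hn
  · have : (b - m).toNat = (b - n).toNat + 1 := by omega
    rw [this]
    exact le_rfl
  · exact fun _ _ => Submodule.mem_top

theorem extensionKernel_le_ker {m n : ℤ} (hmn : m + 1 = n) (hm : b - h ≤ m ∧ m < b) :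
    extensionKernel W b g h m ≤ LinearMap.ker (extensionEval W b g n) := by
  intro v hv
  rw [LinearMap.mem_ker]
  by_cases hn : n = b
  · subst hn
    have : (n - m).toNat = 1 := by omega
    rw [extensionKernel, if_pos hm, this] at hv
    have hv' : Finsupp.linearCombination R g (frobV R p I v) = 0 := hv
    simpa [extensionEval] using hv'
  · have : (fun i => (Pi.single b (g i) : ∀ k, W.piece k) n) = 0 := by
      funext i
      simp [hn]
    simp [extensionEval, this]

/-- The component of degree `n` of the `h`-place extension: `Wₙ × V/Lₙ`, where `Lₙ` is
`extensionKernel W b g h n`. The second factor is `0` unless `b - h ≤ n < b`, and the first one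
is `0` for `n < b` when `W` is concentrated in degrees `≥ b`. -/
abbrev ExtensionPiece (n : ℤ) : Type max u v w :=
  W.piece n × ((I →₀ R) ⧸ extensionKernel W b g h n)

/-- Multiplication by `x` on the `h`-place extension: for `b - h ≤ m < b` it is
`(t, v + Lₘ) ↦ (x t + extensionEval v, f(v) + Lₘ₊₁)`, otherwise it is `(t, 0) ↦ (x t, 0)`. -/
def extensionX {m n : ℤ} (hmn : m + 1 = n) :
    ExtensionPiece W b g h m →+ ExtensionPiece W b g h n :=
  if hm : b - h ≤ m ∧ m < b then
    AddMonoidHom.prod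
      ((W.x hmn).comp (AddMonoidHom.fst _ _) +
        (((extensionKernel W b g h m).liftQ (extensionEval W b g n)
          (extensionKernel_le_ker W b g h hmn hm)).toAddMonoidHom).comp (AddMonoidHom.snd _ _))
      ((((extensionKernel W b g h m).mapQ (extensionKernel W b g h n) (frobV R p I)
          (extensionKernel_le_comap W b g h hmn hm)).toAddMonoidHom).comp
        (AddMonoidHom.snd _ _))
  else
    AddMonoidHom.prod ((W.x hmn).comp (AddMonoidHom.fst _ _)) 0

/-- Let `W` be a graded left `R[x,f]`-module with `Wₙ = 0` for `n < b`, let `(gᵢ)` be a family of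
elements of `W_b`, let `V = ⨁_{i ∈ I} R` and `K = {(rᵢ) ∈ V : ∑ rᵢ gᵢ = 0}`. The `h`-place
extension of `W` by `(gᵢ)` is the graded left `R[x,f]`-module
`V/f⁻ʰ(K) ⊕ ⋯ ⊕ V/f⁻¹(K) ⊕ W_b ⊕ W_{b+1} ⊕ ⋯`, with `V/f⁻ʲ(K)` in degree `b - j`, in which
`x` acts on `W` as it does in `W`, maps `v + f⁻ʲ(K)` to `f(v) + f⁻⁽ʲ⁻¹⁾(K)` for `2 ≤ j ≤ h`, and
maps `(rᵢ) + f⁻¹(K)` to `∑ rᵢ ^ p gᵢ ∈ W_b`. The `0`-place extension is `W`. -/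
def extension : GradedSkewModule.{u, max u v w} R p where
  piece := ExtensionPiece W b g h
  addCommGroup _ := inferInstance
  module _ := inferInstance
  x hmn := extensionX W b g h hmn
  x_smul {m n} hmn r t := by
    unfold extensionX
    split_ifs with hm
    · ext1
      · simp [W.x_smul, LinearMap.map_smulₛₗ, frobenius_def]
      · simp [LinearMap.map_smulₛₗ, frobenius_def]
    · ext1
      · simp [W.x_smul]
      · simp

/-- On `V/f⁻¹(K)`, multiplication by `x` is `(rᵢ) + f⁻¹(K) ↦ ∑ rᵢ ^ p gᵢ`. -/
theorem extensionX_top {m : ℤ} (hm : m + 1 = b) (hh : 1 ≤ h) (v : I →₀ R) :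
    extensionX W b g h hm (0, Submodule.Quotient.mk v) =
      (v.sum fun i r => r ^ p • g i, 0) := by
  have hm' : b - h ≤ m ∧ m < b := by omega
  have hb : extensionKernel W b g h b = ⊤ := by simp [extensionKernel]
  ext1
  · simp [extensionX, hm', extensionEval, frobV, Finsupp.linearCombination_apply,
      Finsupp.sum_mapRange_index, frobenius_def]
  · simp [extensionX, hm', Submodule.Quotient.mk_eq_zero, hb]

/-- Below that, multiplication by `x` is `v + f⁻ʲ(K) ↦ f(v) + f⁻⁽ʲ⁻¹⁾(K)`. -/
theorem extensionX_below {m n : ℤ} (hmn : m + 1 = n) (hm : b - h ≤ m) (hn : n < b)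
    (v : I →₀ R) :
    extensionX W b g h hmn (0, Submodule.Quotient.mk v) =
      (0, Submodule.Quotient.mk (frobV R p I v)) := by
  have hm' : b - h ≤ m ∧ m < b := by omega
  ext1
  · simp [extensionX, hm', extensionEval, hn.ne, Finsupp.linearCombination_apply]
  · simp [extensionX, hm']

end Extension

end GradedSkewModule

/-- `i : N → E` exhibits `E` as an injective envelope of `N`: `E` is an injective module and `i` is
an essential monomorphism. -/
def IsInjectiveEnvelope {R : Type u} [CommRing R] {N : Type v} [AddCommGroup N] [Module R N]
    {E : Type w} [AddCommGroup E] [Module R E] (i : N →ₗ[R] E) : Prop :=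
  Module.Injective R E ∧ Function.Injective i ∧
    ∀ L : Submodule R E, L ⊓ LinearMap.range i = ⊥ → L = ⊥

end

/-!
The residue field of the local ring `R` has `G₀` as an injective envelope, so the homomorphisms to
`G₀` separate the points of every `R`-module. Applied to `R[x,f] ⊗_R M` with its left `R`-module
structure, this gives an injective `R`-homomorphism `φₙ` to the component of degree `n` of
`Wₙ = (∏' G)(-n)`, for each `n` (`exists_injective_pi`). Let `H⁽ⁿ⁾` be the `n`-place extension of
`Wₙ` by the elements `φₙ(xⁿ ⊗ m)`, `m ∈ M`. A relation `∑ rₘ m = 0` in `M` gives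
`∑ rₘ ^ pⁿ φₙ(xⁿ ⊗ m) = 0`, and the relations of `V/f⁻ⁿ(L)`, the component of degree `0`, are
exactly those of the latter kind; so sending `m` to the class of the basis element `eₘ` is
`R`-linear (`extensionGeneratorLinear`), and extends to an `R[x,f]`-homomorphism
`ν : R[x,f] ⊗_R M → ∏' H⁽ⁿ⁾` by the universal property of the tensor product. As
`xⁿ eₘ = φₙ(xⁿ ⊗ m)`, the coordinate of index `n` of `ν` agrees with `φₙ` in degree `n`, and `ν` is
injective in each degree (`tensorToExtensionProduct_injective`).

For an `x`-torsion-free module `H`, the graded annihilator of a submodule `N` is `𝔠R[x,f]` with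
`𝔠 = (0 :_R N)` (`isGradedAnnihilator_extendedIdeal`). Hence `𝓘(H)` is the set of all intersections
of ideals `(0 :_R R[x,f]h)` with `h ∈ H`, and these ideals do not change when `h` is replaced by
`xʲh`. Since `x ^ n` carries `H⁽ⁿ⁾` into `Wₙ`, where every such ideal is an intersection of ideals
that belong to `G`, passing from `G` to `K = ∏' H⁽ⁿ⁾` gives no new special ideals
(`specialIdeals_gradedProduct_extension`).

If `𝓘(G)` is finite, the intersection `𝔟` of its members of positive height is special and has
positive height. If `h ∈ K` and `c xⁿ h = 0` for `n ≥ n₀`, with `c` outside the minimal primes,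
then `c` lies in the special ideal `(0 :_R R[x,f] xⁿ⁰ h) = (0 :_R R[x,f] h)`, which therefore has
positive height and contains `𝔟` (`isIdealTestable_of_isLeast`). Testability passes from `K` to
`R[x,f] ⊗_R M` along `ν`.
-/

noncomputable section

/-! ### Elements of the Frobenius skew polynomial ring -/

namespace FrobSkew

variable {R : Type u} [CommRing R] {p : ℕ} [Fact p.Prime] [CharP R p]

theorem coeff_add (a b : FrobSkew R p) (n : ℕ) : coeff (a + b) n = coeff a n + coeff b n :=
  SkewPolynomial.coeff_add a b n

theorem coeff_neg (a : FrobSkew R p) (n : ℕ) : coeff (-a) n = -coeff a n :=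
  SkewPolynomial.coeff_neg a n

theorem coeff_C (r : R) (n : ℕ) : coeff (C p r) n = if 0 = n then r else 0 := by
  simpa using coeff_C_mul_X_pow (p := p) r 0 n

theorem eq_sum_coeff (a : FrobSkew R p) :
    ∃ s : Finset ℕ, a = ∑ n ∈ s, C p (coeff a n) * X p ^ n := by
  let _ := frobeniusAction R p
  refine ⟨SkewPolynomial.support a, ?_⟩
  refine (SkewPolynomial.sum_monomial (R := R) a).symm.trans
    ((SkewPolynomial.sum_def (R := R) a _).trans (Finset.sum_congr rfl fun n _ => ?_))
  exact (SkewPolynomial.C_mul_X_pow_eq_monomial (R := R) (n := n)).symm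

theorem X_pow_mul_C (n : ℕ) (r : R) :
    (X p : FrobSkew R p) ^ n * C p r = C p (r ^ p ^ n) * X p ^ n := by
  induction n generalizing r with
  | zero => simp
  | succ n ih =>
    rw [pow_succ, mul_assoc, X_mul_C, ← mul_assoc, ih, mul_assoc, ← pow_mul, ← pow_succ']

theorem monomial_mul_monomial (r s : R) (m n : ℕ) :
    (C p r * X p ^ m) * (C p s * X p ^ n) =
      C p (r * s ^ p ^ m) * (X p : FrobSkew R p) ^ (m + n) := by
  rw [mul_assoc, ← mul_assoc (X p ^ m), X_pow_mul_C, map_mul, pow_add]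
  simp only [mul_assoc]

variable {H : Type v} [AddCommGroup H] [Module (FrobSkew R p) H]
  {H' : Type w} [AddCommGroup H'] [Module (FrobSkew R p) H']

/-- An additive map that commutes with `R` and with `x` is `R[x,f]`-linear. -/
def linearMapOfCommutes (φ : H →+ H') (hC : ∀ (r : R) h, φ (C p r • h) = C p r • φ h)
    (hX : ∀ h, φ ((X p : FrobSkew R p) • h) = (X p : FrobSkew R p) • φ h) :
    H →ₗ[FrobSkew R p] H' where
  toFun := φ
  map_add' := φ.map_add
  map_smul' a h := by
    have hXn (n : ℕ) (h) : φ ((X p : FrobSkew R p) ^ n • h) = (X p : FrobSkew R p) ^ n • φ h := by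
      induction n with
      | zero => simp
      | succ n ih => rw [pow_succ', mul_smul, hX, ih, mul_smul]
    obtain ⟨s, hs⟩ := eq_sum_coeff a
    rw [RingHom.id_apply, hs, Finset.sum_smul, Finset.sum_smul, map_sum]
    exact Finset.sum_congr rfl fun n _ => by rw [mul_smul, hC, hXn, mul_smul]

end FrobSkew

/-! ### Special ideals of torsion-free modules -/

section Annihilators

open FrobSkew

variable {R : Type u} [CommRing R] {p : ℕ} [Fact p.Prime] [CharP R p]
  {H : Type v} [AddCommGroup H] [Module (FrobSkew R p) H]
  {H' : Type w} [AddCommGroup H'] [Module (FrobSkew R p) H']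

theorem FrobSkew.X_pow_smul_monomial_smul (j n : ℕ) (r : R) (h : H) :
    (X p : FrobSkew R p) ^ j • (C p r * X p ^ n) • h =
      (C p (r ^ p ^ j) * X p ^ (j + n)) • h := by
  rw [smul_smul, ← mul_assoc, X_pow_mul_C, mul_assoc, pow_add]

variable (p H) in
/-- The elements `h` of a left `R[x,f]`-module with `r xⁿ h = 0` for all `n`. -/
def xStableKilledBy (r : R) : Submodule (FrobSkew R p) H where
  carrier := {h | ∀ n : ℕ, (C p r * X p ^ n) • h = 0}
  add_mem' ha hb n := by rw [smul_add, ha n, hb n, add_zero]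
  zero_mem' n := smul_zero _
  smul_mem' a h hh n := by
    obtain ⟨s, hs⟩ := eq_sum_coeff a
    rw [hs, Finset.sum_smul, Finset.smul_sum]
    refine Finset.sum_eq_zero fun m _ => ?_
    rw [smul_smul, monomial_mul_monomial, mul_comm r, map_mul, mul_assoc, mul_smul, hh, smul_zero]

/-- The ideal `(0 :_R N)` of the elements of `R` that kill the `R[x,f]`-submodule `N`. As `N` is
stable under `x`, it consists of the `r` with `r xⁿ h = 0` for all `h ∈ N` and all `n`. -/
def scalarAnnihilator (N : Submodule (FrobSkew R p) H) : Ideal R where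
  carrier := {r | N ≤ xStableKilledBy p H r}
  add_mem' ha hb h hh n := by
    rw [map_add, add_mul, add_smul, ha hh n, hb hh n, add_zero]
  zero_mem' h _ n := by simp
  smul_mem' s r hr h hh n := by
    rw [smul_eq_mul, map_mul, mul_assoc, mul_smul, hr hh n, smul_zero]

theorem mem_scalarAnnihilator {N : Submodule (FrobSkew R p) H} {r : R} :
    r ∈ scalarAnnihilator N ↔ N ≤ xStableKilledBy p H r := Iff.rfl

theorem mem_scalarAnnihilator_span {h : H} {r : R} :
    r ∈ scalarAnnihilator (Submodule.span (FrobSkew R p) {h}) ↔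
      ∀ n : ℕ, (C p r * X p ^ n) • h = 0 := by
  rw [mem_scalarAnnihilator, Submodule.span_singleton_le_iff_mem]
  rfl

theorem scalarAnnihilator_iSup {ι : Sort*} (N : ι → Submodule (FrobSkew R p) H) :
    scalarAnnihilator (⨆ i, N i) = ⨅ i, scalarAnnihilator (N i) := by
  ext r
  simp [mem_scalarAnnihilator]

theorem scalarAnnihilator_span_map {φ : H →ₗ[FrobSkew R p] H'} (hφ : Function.Injective φ)
    (h : H) : scalarAnnihilator (Submodule.span (FrobSkew R p) {φ h}) =
      scalarAnnihilator (Submodule.span (FrobSkew R p) {h}) := by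
  ext r
  simp_rw [mem_scalarAnnihilator_span, ← map_smul, map_eq_zero_iff φ hφ]

theorem scalarAnnihilator_span_of_jointly_injective {ι : Sort*} {T : ι → Type w}
    [∀ i, AddCommGroup (T i)] [∀ i, Module (FrobSkew R p) (T i)]
    (φ : ∀ i, H →ₗ[FrobSkew R p] T i) (hφ : ∀ h, (∀ i, φ i h = 0) → h = 0) (h : H) :
    scalarAnnihilator (Submodule.span (FrobSkew R p) {h}) =
      ⨅ i, scalarAnnihilator (Submodule.span (FrobSkew R p) {φ i h}) := by
  ext r
  simp_rw [Ideal.mem_iInf, mem_scalarAnnihilator_span, ← map_smul]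
  exact ⟨fun hr i n => by rw [hr, map_zero], fun hr n => hφ _ fun i => hr i n⟩

theorem IsXTorsionFree.of_jointly_injective {ι : Sort*} {T : ι → Type w}
    [∀ i, AddCommGroup (T i)] [∀ i, Module (FrobSkew R p) (T i)]
    (hT : ∀ i, IsXTorsionFree R p (T i))
    (φ : ∀ i, H →ₗ[FrobSkew R p] T i) (hφ : ∀ h, (∀ i, φ i h = 0) → h = 0) :
    IsXTorsionFree R p H := by
  rintro h ⟨n, hn⟩
  exact hφ h fun i => hT i _ ⟨n, by rw [← map_smul, hn, map_zero]⟩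

theorem IsXTorsionFree.of_X_smul
    (hH : ∀ h : H, (X p : FrobSkew R p) • h = 0 → h = 0) : IsXTorsionFree R p H := by
  rintro h ⟨n, hn⟩
  induction n with
  | zero => simpa using hn
  | succ n ih => exact ih (hH _ (by rwa [smul_smul, ← pow_succ']))

/-- In an `x`-torsion-free module, a condition `r xⁿ h = 0` need only be checked for large `n`: if
`r xⁿ h = 0` then `x ^ n` kills `r h`. -/
theorem scalarAnnihilator_span_X_pow_smul (hH : IsXTorsionFree R p H) (j : ℕ) (h : H) :
    scalarAnnihilator (Submodule.span (FrobSkew R p) {(X p : FrobSkew R p) ^ j • h}) =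
      scalarAnnihilator (Submodule.span (FrobSkew R p) {h}) := by
  ext r
  simp_rw [mem_scalarAnnihilator_span, smul_smul, mul_assoc, ← pow_add]
  refine ⟨fun hr n => hH _ ⟨j, ?_⟩, fun hr n => hr (n + j)⟩
  obtain ⟨k, hk⟩ : r ∣ r ^ p ^ j := dvd_pow_self r (pow_pos (Fact.out : p.Prime).pos j).ne'
  rw [X_pow_smul_monomial_smul, hk, mul_comm r, map_mul, mul_assoc, mul_smul, add_comm j, hr,
    smul_zero]

/-- The two-sided ideal `𝔠R[x,f] = ⨁ₙ 𝔠xⁿ`. -/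
def extendedIdeal (p : ℕ) [Fact p.Prime] [CharP R p] (c : Ideal R) :
    TwoSidedIdeal (FrobSkew R p) :=
  let S : AddSubgroup (FrobSkew R p) :=
    { carrier := {a | ∀ n, coeff a n ∈ c}
      zero_mem' := fun n => c.zero_mem
      add_mem' := fun ha hb n => by rw [coeff_add]; exact c.add_mem (ha n) (hb n)
      neg_mem' := fun ha n => by rw [coeff_neg]; exact c.neg_mem (ha n) }
  have hS (a b : FrobSkew R p) (h : ∀ m n, coeff a m * coeff b n ^ p ^ m ∈ c) : a * b ∈ S := by
    obtain ⟨s, hs⟩ := eq_sum_coeff a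
    obtain ⟨t, ht⟩ := eq_sum_coeff b
    rw [hs, ht, Finset.sum_mul_sum]
    refine S.sum_mem fun m _ => S.sum_mem fun n _ => fun k => ?_
    rw [monomial_mul_monomial, coeff_C_mul_X_pow]
    split_ifs
    · exact h m n
    · exact c.zero_mem
  TwoSidedIdeal.mk' S S.zero_mem S.add_mem S.neg_mem
    (fun {a b} hb => hS a b fun m n => c.mul_mem_left _
      (c.pow_mem_of_mem (hb n) _ (pow_pos (Fact.out : p.Prime).pos m)))
    (fun {a b} ha => hS a b fun m _ => c.mul_mem_right _ (ha m))

theorem mem_extendedIdeal {c : Ideal R} {a : FrobSkew R p} :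
    a ∈ extendedIdeal p c ↔ ∀ n, coeff a n ∈ c :=
  by rw [extendedIdeal, TwoSidedIdeal.mem_mk']; rfl

/-- A homogeneous element `r xⁿ` of a graded two-sided ideal that kills `N` satisfies `r h = 0` for
`h ∈ N`, since `xⁿ r h` is a multiple of `r xⁿ h`. So the ideals of coefficients of the graded
annihilator are the same in all degrees. -/
theorem isGradedAnnihilator_extendedIdeal (hH : IsXTorsionFree R p H)
    (N : Submodule (FrobSkew R p) H) :
    IsGradedAnnihilator N (extendedIdeal p (scalarAnnihilator N)) := by
  refine ⟨⟨fun a ha n => mem_extendedIdeal.2 fun k => ?_, fun a ha h hh => ?_⟩, ?_⟩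
  · rw [coeff_C_mul_X_pow]
    split_ifs
    · exact mem_extendedIdeal.1 ha n
    · exact Ideal.zero_mem _
  · obtain ⟨s, hs⟩ := eq_sum_coeff a
    rw [hs, Finset.sum_smul]
    exact Finset.sum_eq_zero fun n _ => mem_extendedIdeal.1 ha n hh n
  · rintro B ⟨hB, hBN⟩ a ha
    refine mem_extendedIdeal.2 fun n => mem_scalarAnnihilator.2 fun h hh => ?_
    have hspan : coeff a n ∈ scalarAnnihilator
        (Submodule.span (FrobSkew R p) {(X p : FrobSkew R p) ^ n • h}) := by
      rw [mem_scalarAnnihilator_span]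
      intro k
      rw [smul_smul, mul_assoc, ← pow_add, add_comm, pow_add, ← mul_assoc, mul_smul]
      exact hBN _ (hB a ha n) _ (N.smul_mem _ hh)
    rw [scalarAnnihilator_span_X_pow_smul hH, mem_scalarAnnihilator_span] at hspan
    exact hspan

/-- The special ideals of an `x`-torsion-free module are the annihilators in `R` of its
`R[x,f]`-submodules. -/
theorem mem_specialIdeals_iff (hH : IsXTorsionFree R p H) {c : Ideal R} :
    c ∈ specialIdeals R p H ↔ ∃ N : Submodule (FrobSkew R p) H, scalarAnnihilator N = c := by
  constructor
  · rintro ⟨N, B, hB, hBc⟩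
    refine ⟨N, ?_⟩
    rw [hB.unique (isGradedAnnihilator_extendedIdeal hH N)] at hBc
    ext r
    simpa [mem_extendedIdeal, coeff_C, apply_ite] using hBc (C p r)
  · rintro ⟨N, rfl⟩
    exact ⟨N, _, isGradedAnnihilator_extendedIdeal hH N, fun a => mem_extendedIdeal⟩

theorem iInf_mem_specialIdeals (hH : IsXTorsionFree R p H) {ι : Sort*} {c : ι → Ideal R}
    (hc : ∀ i, c i ∈ specialIdeals R p H) : ⨅ i, c i ∈ specialIdeals R p H := by
  choose N hN using fun i => (mem_specialIdeals_iff hH).1 (hc i)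
  exact (mem_specialIdeals_iff hH).2 ⟨⨆ i, N i, by simp_rw [scalarAnnihilator_iSup, hN]⟩

/-- Special ideals are intersections of annihilators of cyclic submodules, so that an inclusion of
sets of special ideals need only be checked on these. -/
theorem specialIdeals_subset (hH : IsXTorsionFree R p H) (hH' : IsXTorsionFree R p H')
    (h : ∀ z : H, scalarAnnihilator (Submodule.span (FrobSkew R p) {z}) ∈
      specialIdeals R p H') :
    specialIdeals R p H ⊆ specialIdeals R p H' := by
  intro c hc
  obtain ⟨N, rfl⟩ := (mem_specialIdeals_iff hH).1 hc
  have hN : N = ⨆ z : N, Submodule.span (FrobSkew R p) {(z : H)} := by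
    refine le_antisymm (fun z hz => ?_) (iSup_le fun z => ?_)
    · exact Submodule.mem_iSup_of_mem ⟨z, hz⟩ (Submodule.mem_span_singleton_self z)
    · exact (Submodule.span_singleton_le_iff_mem _ _).2 z.2
  rw [hN, scalarAnnihilator_iSup]
  exact iInf_mem_specialIdeals hH' fun z => h z

theorem scalarAnnihilator_mem_specialIdeals (hH : IsXTorsionFree R p H)
    (N : Submodule (FrobSkew R p) H) : scalarAnnihilator N ∈ specialIdeals R p H :=
  (mem_specialIdeals_iff hH).2 ⟨N, rfl⟩

/-- A finite set of special ideals has a smallest member of positive height: the intersection of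
all its members of positive height is special, and a prime of height `0` that contains it contains
one of them. The unit ideal, of height `⊤`, is the annihilator of `0`. -/
theorem exists_isLeast_specialIdeals (hH : IsXTorsionFree R p H)
    (hfin : (specialIdeals R p H).Finite) :
    ∃ b, IsLeast {c | c ∈ specialIdeals R p H ∧ 0 < c.height} b := by
  set S := {c | c ∈ specialIdeals R p H ∧ 0 < c.height} with hS
  have hSfin : S.Finite := hfin.subset fun c hc => hc.1
  refine ⟨⨅ c : S, (c : Ideal R), ⟨iInf_mem_specialIdeals hH fun c => c.2.1, ?_⟩,
    fun c hc => iInf_le (fun c : S => (c : Ideal R)) ⟨c, hc⟩⟩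
  refine pos_iff_ne_zero.2 fun h0 => ?_
  obtain ⟨P, hP, hle, hP0⟩ := Ideal.exists_isPrime_height_eq (n := 0) h0
  have := hSfin.fintype
  obtain ⟨c, hc⟩ : ∃ c : S, (c : Ideal R) ≤ P := by
    rw [← Finset.inf_univ_eq_iInf] at hle
    obtain ⟨c, -, hc⟩ := (Ideal.IsPrime.inf_le' hP).1 hle
    exact ⟨c, hc⟩
  exact c.2.2.not_ge ((Ideal.height_mono hc).trans hP0.le)

theorem IsIdealTestable.of_injective {φ : H →ₗ[FrobSkew R p] H'} (hφ : Function.Injective φ)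
    {b : Ideal R} (hb : IsIdealTestable R p H' b) : IsIdealTestable R p H b := by
  intro a ha h c hc hch n
  refine hφ ?_
  rw [map_smul, map_zero]
  exact hb a ha (φ h) c hc (hch.mono fun m hm => by rw [← map_smul, hm, map_zero]) n

/-- If `c xⁿ h = 0` for all `n ≥ n₀`, then `c` lies in the special ideal that annihilates
`R[x,f] x^n₀ h`; as `c` avoids the minimal primes, this ideal has positive height. -/
theorem isIdealTestable_of_isLeast (hH : IsXTorsionFree R p H) {b : Ideal R}
    (hb : IsLeast {c | c ∈ specialIdeals R p H ∧ 0 < c.height} b) : IsIdealTestable R p H b := by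
  intro a ha h c hc hch
  obtain ⟨n₀, hn₀⟩ := Filter.eventually_atTop.1 hch
  set d := scalarAnnihilator (Submodule.span (FrobSkew R p) {(X p : FrobSkew R p) ^ n₀ • h})
    with hd
  have hcd : c ∈ d := by
    rw [hd, mem_scalarAnnihilator_span]
    intro n
    rw [smul_smul, mul_assoc, ← pow_add]
    exact hn₀ _ (Nat.le_add_left _ _)
  have hdpos : 0 < d.height := by
    refine pos_iff_ne_zero.2 fun h0 => ?_
    obtain ⟨P, hP, hle, hP0⟩ := Ideal.exists_isPrime_height_eq (n := 0) h0
    exact hc P (Ideal.height_eq_zero_iff.1 hP0) (hle hcd)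
  have had : a ∈ d := hb.2 ⟨scalarAnnihilator_mem_specialIdeals hH _, hdpos⟩ ha
  rw [hd, scalarAnnihilator_span_X_pow_smul hH] at had
  exact mem_scalarAnnihilator_span.1 had

end Annihilators

/-! ### Homomorphisms of graded modules -/

namespace GradedSkewModule

variable {R : Type u} [CommRing R] {p : ℕ}

namespace Total

variable {A : GradedSkewModule.{u, v} R p} {B : GradedSkewModule.{u, w} R p}

variable (A) in
/-- The homogeneous component of degree `n`. -/
def component (n : ℤ) : A.Total →+ A.piece n := DFinsupp.evalAddMonoidHom n

theorem component_of (n : ℤ) (a : A.piece n) : component A n (of A n a) = a :=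
  DirectSum.of_eq_same n a

theorem component_of_ne {m n : ℤ} (h : m ≠ n) (a : A.piece m) :
    component A n (of A m a) = 0 :=
  DirectSum.of_eq_of_ne m n a h.symm

theorem of_injective (n : ℤ) : Function.Injective (of A n) := fun a b h => by
  rw [← component_of n a, h, component_of]

theorem eq_zero_of_component {z : A.Total} (h : ∀ n, component A n z = 0) : z = 0 :=
  DFinsupp.ext h

theorem induction_of {motive : A.Total → Prop} (z : A.Total) (zero : motive 0)
    (of' : ∀ n (a : A.piece n), motive (of A n a))
    (add : ∀ y z, motive y → motive z → motive (y + z)) : motive z :=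
  DirectSum.induction_on z zero of' add

/-- The additive map given by additive maps `A_n → B_{σ n}`. -/
def mapAddHom (σ : ℤ → ℤ) (φ : ∀ n, A.piece n →+ B.piece (σ n)) : A.Total →+ B.Total :=
  DirectSum.toAddMonoid fun n => (of B (σ n)).comp (φ n)

theorem mapAddHom_of (σ : ℤ → ℤ) (φ : ∀ n, A.piece n →+ B.piece (σ n)) (n : ℤ) (a : A.piece n) :
    mapAddHom σ φ (of A n a) = of B (σ n) (φ n a) :=
  DirectSum.toAddMonoid_of _ _ _

variable [Fact p.Prime] [CharP R p]

theorem component_X_smul {m n : ℤ} (h : m + 1 = n) (z : A.Total) :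
    component A n ((FrobSkew.X p : FrobSkew R p) • z) = A.x h (component A m z) := by
  induction z using induction_of with
  | zero => simp
  | of' k a =>
    rw [X_smul_of A rfl]
    by_cases hk : k = m
    · subst hk
      subst h
      rw [component_of, component_of]
    · rw [component_of_ne hk, map_zero, component_of_ne (by omega)]
  | add y z hy hz => rw [smul_add, map_add, map_add, map_add, hy, hz]

theorem exists_X_pow_smul_of (j : ℕ) (n : ℤ) (a : A.piece n) :
    ∃ a' : A.piece (n + j), (FrobSkew.X p : FrobSkew R p) ^ j • of A n a = of A (n + j) a' := by
  induction j with
  | zero =>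
    have : ∀ m, m = n → ∃ a' : A.piece m, of A n a = of A m a' := by
      rintro m rfl
      exact ⟨a, rfl⟩
    simpa using this (n + (0 : ℕ)) (by simp)
  | succ j ih =>
    obtain ⟨a', ha'⟩ := ih
    exact ⟨A.x (by push_cast; ring) a', by rw [pow_succ', mul_smul, ha', X_smul_of]⟩

/-- The `R[x,f]`-linear map given by `R`-linear maps `A_n → B_{σ n}` that commute with `x`, where
`σ` is a change of degrees (the identity or a shift). -/
def map (σ : ℤ → ℤ) (hσ : ∀ m n : ℤ, m + 1 = n → σ m + 1 = σ n)
    (φ : ∀ n, A.piece n →ₗ[R] B.piece (σ n))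
    (hφ : ∀ (m n : ℤ) (h : m + 1 = n) (a : A.piece m),
      φ n (A.x h a) = B.x (hσ m n h) (φ m a)) :
    A.Total →ₗ[FrobSkew R p] B.Total :=
  FrobSkew.linearMapOfCommutes (mapAddHom σ fun n => (φ n).toAddMonoidHom)
    (fun r z => by
      induction z using induction_of with
      | zero => simp
      | of' n a => rw [C_smul_of, mapAddHom_of, mapAddHom_of, C_smul_of]; simp
      | add y z hy hz => rw [smul_add, map_add, map_add, smul_add, hy, hz])
    (fun z => by
      induction z using induction_of with
      | zero => simp
      | of' n a =>
        rw [X_smul_of A rfl, mapAddHom_of, mapAddHom_of, X_smul_of B (hσ n _ rfl)]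
        exact congrArg _ (hφ n _ rfl a)
      | add y z hy hz => rw [smul_add, map_add, map_add, smul_add, hy, hz])

section

variable {σ : ℤ → ℤ} {hσ : ∀ m n : ℤ, m + 1 = n → σ m + 1 = σ n}
  {φ : ∀ n, A.piece n →ₗ[R] B.piece (σ n)}
  {hφ : ∀ (m n : ℤ) (h : m + 1 = n) (a : A.piece m),
    φ n (A.x h a) = B.x (hσ m n h) (φ m a)}

theorem map_of (n : ℤ) (a : A.piece n) : map σ hσ φ hφ (of A n a) = of B (σ n) (φ n a) :=
  mapAddHom_of σ (fun n => (φ n).toAddMonoidHom) n a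

theorem component_map (h : Function.Injective σ) (n : ℤ) (z : A.Total) :
    component B (σ n) (map σ hσ φ hφ z) = φ n (component A n z) := by
  induction z using induction_of with
  | zero => simp
  | of' m a =>
    rw [map_of]
    by_cases hm : m = n
    · subst hm
      rw [component_of, component_of]
    · rw [component_of_ne hm, map_zero, component_of_ne (h.ne hm)]
  | add y z hy hz => simp only [map_add, hy, hz]

theorem map_injective (h : Function.Injective σ) (h' : ∀ n, Function.Injective (φ n)) :
    Function.Injective (map σ hσ φ hφ) := by
  rw [injective_iff_map_eq_zero]
  intro z hz
  refine eq_zero_of_component fun n => h' n ?_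
  rw [← component_map h (hσ := hσ) (hφ := hφ), hz, map_zero, map_zero]

end

/-- The `R[x,f]`-linear isomorphism from the total module of a shift, as a linear map. -/
def ofShift (A : GradedSkewModule.{u, v} R p) (s : ℤ) :
    (A.shift s).Total →ₗ[FrobSkew R p] A.Total :=
  map (A := A.shift s) (· + s) (fun _ _ h => by omega) (fun _ => LinearMap.id)
    (fun _ _ _ _ => rfl)

theorem ofShift_injective (s : ℤ) : Function.Injective (ofShift A s) :=
  map_injective (add_left_injective s) fun _ => Function.injective_id

theorem ofShift_surjective (s : ℤ) : Function.Surjective (ofShift A s) := by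
  intro z
  induction z using induction_of with
  | zero => exact ⟨0, map_zero _⟩
  | of' n a =>
    obtain ⟨m, rfl⟩ : ∃ m, n = m + s := ⟨n - s, by omega⟩
    exact ⟨of (A.shift s) m a, map_of _ _⟩
  | add y z hy hz =>
    obtain ⟨y', rfl⟩ := hy
    obtain ⟨z', rfl⟩ := hz
    exact ⟨y' + z', map_add _ _ _⟩

section Product

variable {Y : Type v} (T : Y → GradedSkewModule.{u, w} R p)

/-- The projections of a graded product. -/
def proj (y : Y) : (gradedProduct T).Total →ₗ[FrobSkew R p] (T y).Total :=
  map (A := gradedProduct T) id (fun _ _ => id) (fun _ => LinearMap.proj y) (fun _ _ _ _ => rfl)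

theorem eq_zero_of_proj (z : (gradedProduct T).Total) (h : ∀ y, proj T y z = 0) : z = 0 := by
  refine eq_zero_of_component fun n => funext fun y => ?_
  have := component_map (A := gradedProduct T) (σ := id) (hσ := fun _ _ => id)
    (φ := fun _ => LinearMap.proj y) (hφ := fun _ _ _ _ => rfl) Function.injective_id n z
  refine this.symm.trans ?_
  change component (T y) n (proj T y z) = 0
  rw [h y, map_zero]

open Classical in
/-- The inclusion of a factor of a graded product. -/
def single (y : Y) : (T y).Total →ₗ[FrobSkew R p] (gradedProduct T).Total :=
  map (B := gradedProduct T) id (fun _ _ => id)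
    (fun n => LinearMap.single R (fun y => (T y).piece n) y)
    (fun m n h a => funext fun y' =>
      (Pi.apply_single (M := fun y' => (T y').piece m) (N := fun y' => (T y').piece n)
        (fun y' => (T y').x h) (fun _ => map_zero _) y a y').symm)

theorem single_injective (y : Y) : Function.Injective (single T y) := by
  classical exact map_injective Function.injective_id fun n =>
    Pi.single_injective (M := fun y => (T y).piece n) y

end Product

/-- The diagonal embedding in a graded product of copies of a graded module. -/
def diagonal (A : GradedSkewModule.{u, w} R p) (Y : Type v) :
    A.Total →ₗ[FrobSkew R p] (gradedProduct fun _ : Y => A).Total :=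
  map (B := gradedProduct fun _ : Y => A) id (fun _ _ => id)
    (fun _ => LinearMap.pi fun _ => LinearMap.id) (fun _ _ _ _ => rfl)

theorem diagonal_injective (Y : Type v) [Nonempty Y] : Function.Injective (diagonal A Y) :=
  map_injective Function.injective_id fun _ => Function.const_injective

end Total

end GradedSkewModule

/-! ### Extensions of graded modules -/

namespace GradedSkewModule

open Total

variable {R : Type u} [CommRing R] {p : ℕ}

theorem IsNatGraded.subsingleton_shift_gradedProduct {G : GradedSkewModule.{u, v} R p}
    (hG : G.IsNatGraded) (Y : Type w) (n : ℕ) :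
    ∀ k < (n : ℤ), Subsingleton (((gradedProduct fun _ : Y => G).shift (-(n : ℤ))).piece k) := by
  intro k hk
  have := hG (k + -(n : ℤ)) (by omega)
  exact inferInstanceAs (Subsingleton (Y → G.piece (k + -(n : ℤ))))

variable [Fact p.Prime] [CharP R p]

theorem isXTorsionFree_total_of_x_injective {A : GradedSkewModule.{u, v} R p}
    (hA : ∀ (m n : ℤ) (h : m + 1 = n) (a : A.piece m), A.x h a = 0 → a = 0) :
    IsXTorsionFree R p A.Total :=
  IsXTorsionFree.of_X_smul fun z hz => eq_zero_of_component fun n =>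
    hA n (n + 1) rfl _ (by rw [← component_X_smul, hz, map_zero])

theorem x_injective_of_isXTorsionFree {A : GradedSkewModule.{u, v} R p}
    (hA : IsXTorsionFree R p A.Total) {m n : ℤ} (h : m + 1 = n) {a : A.piece m}
    (ha : A.x h a = 0) : a = 0 := by
  refine of_injective m ?_
  rw [map_zero]
  exact hA _ ⟨1, by rw [pow_one, X_smul_of A h, ha, map_zero]⟩

section Extension

variable {I : Type w} (W : GradedSkewModule.{u, v} R p) (b : ℤ) (g : I → W.piece b) (h : ℕ)

theorem subsingleton_quotient_extensionKernel {n : ℤ} (hn : ¬(b - h ≤ n ∧ n < b)) :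
    Subsingleton ((I →₀ R) ⧸ extensionKernel W b g h n) := by
  rw [extensionKernel, if_neg hn]
  exact Submodule.Quotient.subsingleton_iff.2 rfl

theorem isNatGraded_extension (hW : ∀ n < b, Subsingleton (W.piece n)) (hb : 0 ≤ b)
    (hbh : b ≤ h) (hh : h ≤ b) : (extension W b g h).IsNatGraded := by
  intro n hn
  have := hW n (by omega)
  have := subsingleton_quotient_extensionKernel W b g h (n := n) (by omega)
  exact inferInstanceAs (Subsingleton (ExtensionPiece W b g h n))

/-- The inclusion of `W` in an extension of `W`. -/
def toExtension : W.Total →ₗ[FrobSkew R p] (extension W b g h).Total :=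
  map (B := extension W b g h) id (fun _ _ => id)
    (fun n => LinearMap.inl R (W.piece n) ((I →₀ R) ⧸ extensionKernel W b g h n))
    (fun m n hmn a => by
      change (W.x hmn a, 0) = extensionX W b g h hmn (a, 0)
      unfold extensionX
      split_ifs <;> simp)

theorem toExtension_of (n : ℤ) (a : W.piece n) :
    toExtension W b g h (of W n a) =
      of (extension W b g h) n ((a, 0) : ExtensionPiece W b g h n) :=
  map_of _ _

theorem toExtension_injective : Function.Injective (toExtension W b g h) :=
  map_injective Function.injective_id fun _ => LinearMap.inl_injective

/-- The new components of an `h`-place extension are carried into `W` by `x ^ h`. -/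
theorem X_pow_smul_mem_range_toExtension (z : (extension W b g h).Total) :
    (FrobSkew.X p : FrobSkew R p) ^ h • z ∈ LinearMap.range (toExtension W b g h) := by
  have key (n : ℤ) (hn : ¬(b - h ≤ n ∧ n < b)) (a : (extension W b g h).piece n) :
      of (extension W b g h) n a ∈ LinearMap.range (toExtension W b g h) := by
    have := subsingleton_quotient_extensionKernel W b g h hn
    refine ⟨of W n (a : ExtensionPiece W b g h n).1, ?_⟩
    rw [toExtension_of]
    exact congrArg _ (Prod.ext rfl (Subsingleton.elim _ _))
  induction z using induction_of with
  | zero => rw [smul_zero]; exact Submodule.zero_mem _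
  | of' n a =>
    by_cases hn : b - h ≤ n
    · obtain ⟨a', ha'⟩ := exists_X_pow_smul_of h n a
      rw [ha']
      exact key _ (by omega) _
    · exact Submodule.smul_mem _ _ (key n (by omega) a)
  | add y z hy hz => rw [smul_add]; exact Submodule.add_mem _ hy hz

/-- The kernels `f⁻ʲ(K)` are the ones that make `x` injective on the new components. -/
theorem isXTorsionFree_extension (hW : ∀ n < b, Subsingleton (W.piece n))
    (hWx : IsXTorsionFree R p W.Total) : IsXTorsionFree R p (extension W b g h).Total := by
  refine isXTorsionFree_total_of_x_injective fun m n hmn a ha => ?_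
  obtain ⟨t, v⟩ := a
  change extensionX W b g h hmn (t, v) = 0 at ha
  change ((t, v) : ExtensionPiece W b g h m) = 0
  by_cases hm : b - h ≤ m ∧ m < b
  · have := hW m hm.2
    obtain rfl : t = 0 := Subsingleton.elim _ _
    obtain ⟨v, rfl⟩ := Submodule.Quotient.mk_surjective _ v
    rw [Prod.mk_eq_zero, Submodule.Quotient.mk_eq_zero]
    refine ⟨rfl, ?_⟩
    have hbm : (b - m).toNat = (b - n).toNat + 1 := by omega
    rw [extensionKernel, if_pos hm, hbm]
    change frobV R p I v ∈ frobPreimage (LinearMap.ker _) (b - n).toNat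
    rcases eq_or_lt_of_le (show n ≤ b by omega) with rfl | hn
    · rw [extensionX_top W n g h hmn (by omega), Prod.mk_eq_zero] at ha
      rw [sub_self]
      change Finsupp.linearCombination R g (frobV R p I v) = 0
      rw [← ha.1]
      simp [frobV, Finsupp.linearCombination_apply, Finsupp.sum_mapRange_index, frobenius_def]
    · rw [extensionX_below W b g h hmn hm.1 hn, Prod.mk_eq_zero,
        Submodule.Quotient.mk_eq_zero, extensionKernel, if_pos (by omega)] at ha
      exact ha.2
  · have := subsingleton_quotient_extensionKernel W b g h hm
    rw [extensionX, dif_neg hm] at ha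
    have ht : W.x hmn t = 0 := congrArg Prod.fst ha
    rw [Prod.mk_eq_zero]
    exact ⟨x_injective_of_isXTorsionFree hWx hmn ht, Subsingleton.elim _ _⟩

/-- The element of degree `n` with class `eᵢ` for `n < b`, and the element `gᵢ` for `n = b`. -/
def extensionGenerator (n : ℤ) (i : I) : ExtensionPiece W b g h n :=
  (Pi.single (M := W.piece) b (g i) n, Submodule.Quotient.mk (Finsupp.single i 1))

theorem extensionX_extensionGenerator {m n : ℤ} (hmn : m + 1 = n) (hm : b - h ≤ m) (hb : m < b)
    (i : I) : extensionX W b g h hmn (extensionGenerator W b g h m i) =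
      extensionGenerator W b g h n i := by
  have hm' : b - h ≤ m ∧ m < b := ⟨hm, hb⟩
  ext1
  · simp [extensionX, hm', extensionGenerator, extensionEval, frobV, hb.ne]
  · simp [extensionX, hm', extensionGenerator, frobV]

variable (p) in
/-- The map `(rᵢ) ↦ ∑ rᵢ ^ pʲ gᵢ`, whose kernel is `f⁻ʲ(K)`. -/
def frobLinearCombination {E : Type v} [AddCommGroup E] [Module R E] (g : I → E) (j : ℕ) :
    (I →₀ R) →+ E :=
  (Finsupp.linearCombination R g).toAddMonoidHom.comp
    (Finsupp.mapRange.addMonoidHom (iterateFrobenius R p j).toAddMonoidHom)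

theorem frobLinearCombination_single {E : Type v} [AddCommGroup E] [Module R E] (g : I → E)
    (j : ℕ) (i : I) (r : R) :
    frobLinearCombination p g j (Finsupp.single i r) = r ^ p ^ j • g i := by
  simp [frobLinearCombination, iterateFrobenius_def]

theorem mem_frobPreimage_ker_iff {E : Type v} [AddCommGroup E] [Module R E] (g : I → E) (j : ℕ)
    (v : I →₀ R) : v ∈ frobPreimage (p := p) (LinearMap.ker (Finsupp.linearCombination R g)) j ↔
      frobLinearCombination p g j v = 0 := by
  induction j generalizing v with
  | zero =>
    change Finsupp.linearCombination R g v = 0 ↔ _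
    suffices h : frobLinearCombination p g 0 v = Finsupp.linearCombination R g v by rw [h]
    induction v using Finsupp.induction_linear with
    | zero => simp
    | add v w hv hw => rw [map_add, map_add, hv, hw]
    | single i r => simp [frobLinearCombination_single]
  | succ j ih =>
    change frobV R p I v ∈ frobPreimage _ j ↔ _
    rw [ih]
    suffices h : frobLinearCombination p g j (frobV R p I v) =
        frobLinearCombination p g (j + 1) v by rw [h]
    induction v using Finsupp.induction_linear with
    | zero => simp
    | add v w hv hw => rw [map_add, map_add, map_add, hv, hw]
    | single i r =>
      rw [frobLinearCombination_single, pow_succ', pow_mul, ← frobLinearCombination_single]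
      simp [frobV, frobenius_def]

/-- If `g` is semilinear with respect to the `n`-th power of the Frobenius homomorphism, then the
generators of degree `0` of the `n`-place extension in degree `b = n` depend linearly on the
index: the relations between them hold after applying `f ^ n`. -/
def extensionGeneratorLinear {M : Type w} [AddCommGroup M] [Module R M] (n : ℕ)
    (g : M →+ W.piece n) (hg : ∀ (r : R) (m : M), g (r • m) = r ^ p ^ n • g m) :
    M →ₗ[R] ExtensionPiece W n g n 0 :=
  have hker (v : M →₀ R) (hv : frobLinearCombination p g n v = 0) :
      v ∈ extensionKernel W n g n 0 := by
    rw [extensionKernel]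
    split_ifs
    · rw [show ((n : ℤ) - 0).toNat = n by omega]
      exact (mem_frobPreimage_ker_iff g n v).2 hv
    · exact Submodule.mem_top
  { toFun := extensionGenerator W n g n 0
    map_add' := fun a b => by
      refine Prod.ext ?_ ?_
      · exact (congrArg (fun z => Pi.single (M := W.piece) (n : ℤ) z 0) (g.map_add a b)).trans
          (congrFun (Pi.single_add (f := W.piece) (n : ℤ) (g a) (g b)) 0)
      · refine (Submodule.Quotient.eq _).2 (hker _ ?_)
        simp [frobLinearCombination_single]
    map_smul' := fun r a => by
      refine Prod.ext ?_ ?_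
      · change Pi.single (M := W.piece) (n : ℤ) (g (r • a)) 0 =
          r • Pi.single (M := W.piece) (n : ℤ) (g a) 0
        rw [hg]
        rcases n.eq_zero_or_pos with rfl | hn
        · change Pi.single (M := W.piece) (0 : ℤ) (r ^ p ^ 0 • g a) 0 =
            r • Pi.single (M := W.piece) (0 : ℤ) (g a) 0
          rw [Pi.single_eq_same, Pi.single_eq_same, pow_zero, pow_one]
        · have : (0 : ℤ) ≠ n := by omega
          rw [Pi.single_eq_of_ne this, Pi.single_eq_of_ne this, smul_zero]
      · refine (Submodule.Quotient.eq _).2 (hker _ ?_)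
        simp [frobLinearCombination_single, hg] }

end Extension

end GradedSkewModule

/-! ### The tensor product `R[x,f] ⊗_R M` and its maps to products of `G₀` -/

open FrobSkew

/-- Over a local ring, the homomorphisms to an injective envelope of the residue field separate
points. -/
theorem exists_linearMap_ne_zero {R : Type u} [CommRing R] [IsLocalRing R]
    {E : Type u} [AddCommGroup E] [Module R E]
    {i : (R ⧸ IsLocalRing.maximalIdeal R) →ₗ[R] E} (hi : IsInjectiveEnvelope i)
    {T : Type u} [AddCommGroup T] [Module R T] {t : T} (ht : t ≠ 0) :
    ∃ φ : T →ₗ[R] E, φ t ≠ 0 := by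
  have hker : LinearMap.ker (LinearMap.toSpanSingleton R T t) ≤ IsLocalRing.maximalIdeal R :=
    IsLocalRing.le_maximalIdeal fun h => ht <| by
      have h1 : (1 : R) ∈ LinearMap.ker (LinearMap.toSpanSingleton R T t) := h ▸ Submodule.mem_top
      simpa using h1
  obtain ⟨φ, hφ⟩ := hi.1.out
    ((LinearMap.ker (LinearMap.toSpanSingleton R T t)).liftQ (LinearMap.toSpanSingleton R T t)
      le_rfl)
    (LinearMap.ker_eq_bot.1 (Submodule.ker_liftQ_eq_bot _ _ _ le_rfl))
    (i ∘ₗ Submodule.factor hker)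
  refine ⟨φ, fun h0 => ?_⟩
  have h1 := hφ (Submodule.Quotient.mk 1)
  rw [Submodule.liftQ_apply, LinearMap.toSpanSingleton_apply, one_smul, h0, LinearMap.comp_apply,
    eq_comm, map_eq_zero_iff i hi.2.1] at h1
  exact Ideal.Quotient.zero_ne_one_iff.2 (Ideal.IsPrime.ne_top inferInstance) h1.symm

section

variable {R : Type u} [CommRing R] {p : ℕ} [Fact p.Prime] [CharP R p]

/-- A left `R[x,f]`-module, with `r ∈ R` acting as `C p r`, embeds `R`-linearly in a power of an
injective envelope of the residue field. (The action is given through `C p` because the `R`-module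
instance on `R[x,f] ⊗_R M` is the one by right multiplication.) -/
theorem exists_injective_pi [IsLocalRing R] {E : Type u} [AddCommGroup E] [Module R E]
    {i : (R ⧸ IsLocalRing.maximalIdeal R) →ₗ[R] E} (hi : IsInjectiveEnvelope i)
    (T : Type u) [AddCommGroup T] [Module (FrobSkew R p) T] :
    ∃ (Y : Type u) (φ : T →+ (Y → E)), Nonempty Y ∧
      (∀ (r : R) (t : T), φ (C p r • t) = r • φ t) ∧ Function.Injective φ := by
  let _ : Module R T := Module.compHom T (C p)
  refine ⟨T →ₗ[R] E, AddMonoidHom.mk' (fun t f => f t) fun a b => funext fun f => f.map_add a b,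
    ⟨0⟩, fun r t => funext fun f => f.map_smul r t, ?_⟩
  rw [injective_iff_map_eq_zero]
  intro t ht
  by_contra h
  obtain ⟨f, hf⟩ := exists_linearMap_ne_zero hi h
  exact hf (congrFun ht f)

namespace SkewTensor

variable {M : Type v} [AddCommGroup M] [Module R M]

theorem C_mul_X_pow_tmul (r : R) (n : ℕ) (m : M) :
    (C p r * X p ^ n) ⊗ₜ[R] m = (C p r : FrobSkew R p) • ((X p ^ n : FrobSkew R p) ⊗ₜ[R] m) := by
  rw [TensorProduct.smul_tmul', smul_eq_mul]

theorem X_pow_tmul_smul (r : R) (n : ℕ) (m : M) :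
    ((X p ^ n : FrobSkew R p) ⊗ₜ[R] (r • m) : SkewTensor R p M) =
      C p (r ^ p ^ n) • ((X p ^ n : FrobSkew R p) ⊗ₜ[R] m) := by
  rw [← TensorProduct.smul_tmul, right_smul_def, X_pow_mul_C, C_mul_X_pow_tmul]

theorem exists_eq_sum_component (t : SkewTensor R p M) :
    ∃ d : ℕ →₀ SkewTensor R p M, (∀ i, d i ∈ component R p M i) ∧ d.sum (fun _ z => z) = t := by
  classical
  have hadd (d d' : ℕ →₀ SkewTensor R p M) :
      (d + d').sum (fun _ z => z) = d.sum (fun _ z => z) + d'.sum (fun _ z => z) :=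
    Finsupp.sum_add_index' (fun _ => rfl) (fun _ _ _ => rfl)
  induction t using TensorProduct.induction_on with
  | zero => exact ⟨0, fun i => (component R p M i).zero_mem, Finsupp.sum_zero_index⟩
  | add y z hy hz =>
    obtain ⟨d, hd, rfl⟩ := hy
    obtain ⟨d', hd', rfl⟩ := hz
    exact ⟨d + d', fun i => (component R p M i).add_mem (hd i) (hd' i), hadd d d'⟩
  | tmul a m =>
    obtain ⟨s, hs⟩ := eq_sum_coeff a
    rw [hs, TensorProduct.sum_tmul]
    generalize coeff a = c
    clear hs
    induction s using Finset.induction_on with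
    | empty => exact ⟨0, fun i => (component R p M i).zero_mem, Finsupp.sum_zero_index⟩
    | insert n s hn ih =>
      obtain ⟨d, hd, hdsum⟩ := ih
      refine ⟨Finsupp.single n ((C p (c n) * X p ^ n) ⊗ₜ[R] m) + d,
        fun i => (component R p M i).add_mem ?_ (hd i), ?_⟩
      · rw [Finsupp.single_apply]
        split_ifs with hni
        · subst hni
          exact AddSubgroup.subset_closure ⟨_, _, rfl⟩
        · exact (component R p M i).zero_mem
      · rw [hadd, Finsupp.sum_single_index rfl, hdsum, Finset.sum_insert hn]

/-- The universal property of `R[x,f] ⊗_R M`. -/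
def lift {L : Type w} [AddCommGroup L] [Module (FrobSkew R p) L] (β : M →+ L)
    (hβ : ∀ (r : R) (m : M), β (r • m) = C p r • β m) :
    SkewTensor R p M →ₗ[FrobSkew R p] L :=
  let ν : SkewTensor R p M →+ L := TensorProduct.liftAddHom
    (((smulAddHom (FrobSkew R p) L).flip.comp β).flip) fun r a m => by
      change (r • a) • β m = a • β (r • m)
      rw [hβ, right_smul_def, mul_smul]
  { ν with
    map_smul' := fun a t => by
      change ν (a • t) = a • ν t
      induction t using TensorProduct.induction_on with
      | zero => simp
      | add y z hy hz => rw [smul_add, map_add, map_add, smul_add, hy, hz]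
      | tmul b m =>
        rw [TensorProduct.smul_tmul']
        change (a * b) • β m = a • b • β m
        rw [mul_smul] }

theorem lift_tmul {L : Type w} [AddCommGroup L] [Module (FrobSkew R p) L] (β : M →+ L)
    (hβ : ∀ (r : R) (m : M), β (r • m) = C p r • β m) (a : FrobSkew R p) (m : M) :
    lift β hβ (a ⊗ₜ[R] m) = a • β m := rfl

end SkewTensor

namespace GradedSkewModule

open Total

/-! ### The embedding in a product of extensions -/

section Embedding

variable {M : Type u} [AddCommGroup M] [Module R M] (W : ℕ → GradedSkewModule.{u, u} R p)
  (φ : ∀ n : ℕ, SkewTensor R p M →+ (W n).piece n)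

/-- The elements `φₙ(xⁿ ⊗ m)`. -/
def degreeGenerators (n : ℕ) : M →+ (W n).piece n :=
  (φ n).comp ((TensorProduct.mk R (FrobSkew R p) M (X p ^ n)).toAddMonoidHom)

variable {W φ} in
theorem degreeGenerators_smul (hφ : ∀ n (r : R) t, φ n (C p r • t) = r • φ n t) (n : ℕ)
    (r : R) (m : M) :
    degreeGenerators W φ n (r • m) = r ^ p ^ n • degreeGenerators W φ n m := by
  change φ n ((X p ^ n : FrobSkew R p) ⊗ₜ[R] (r • m)) = _
  rw [SkewTensor.X_pow_tmul_smul, hφ]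
  rfl

/-- The graded product of the `n`-place extensions of the `Wₙ` by the elements `φₙ(xⁿ ⊗ m)`. -/
abbrev extensionProduct : GradedSkewModule.{u, u} R p :=
  gradedProduct fun n : ℕ => extension (W n) n (degreeGenerators W φ n) n

variable {W φ} (hφ : ∀ n (r : R) t, φ n (C p r • t) = r • φ n t)

/-- The map from `M` to the component of degree `0` of `∏' H⁽ⁿ⁾` that sends `m` to the family of
the generators with index `m`. -/
def toExtensionProductZero : M →ₗ[R] (extensionProduct W φ).piece 0 :=
  LinearMap.pi (φ := fun n : ℕ => ExtensionPiece (W n) n (degreeGenerators W φ n) n 0) fun n =>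
    extensionGeneratorLinear (W n) n (degreeGenerators W φ n) (degreeGenerators_smul hφ n)

/-- The extension of `toExtensionProductZero` to `R[x,f] ⊗_R M`. -/
def tensorToExtensionProduct : SkewTensor R p M →ₗ[FrobSkew R p] (extensionProduct W φ).Total :=
  SkewTensor.lift
    ((of (extensionProduct W φ) 0).comp (toExtensionProductZero hφ).toAddMonoidHom)
    fun r m => by
      rw [AddMonoidHom.comp_apply, AddMonoidHom.comp_apply, C_smul_of]
      exact congrArg _ ((toExtensionProductZero hφ).map_smul r m)

theorem exists_tensorToExtensionProduct_X_pow_tmul (m : M) (j : ℕ) :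
    ∃ k : (extensionProduct W φ).piece j,
      tensorToExtensionProduct hφ ((X p ^ j : FrobSkew R p) ⊗ₜ[R] m) =
        of (extensionProduct W φ) j k ∧
      ∀ n : ℕ, j ≤ n →
        k n = extensionGenerator (W n) n (degreeGenerators W φ n) n j m := by
  rw [tensorToExtensionProduct, SkewTensor.lift_tmul]
  induction j with
  | zero =>
    refine ⟨_, by rw [pow_zero, one_smul]; rfl, fun n _ => rfl⟩
  | succ j ih =>
    obtain ⟨k, hk, hkn⟩ := ih
    have hj : (j : ℤ) + 1 = (j + 1 : ℕ) := by push_cast; rfl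
    refine ⟨(extensionProduct W φ).x hj k, by rw [pow_succ', mul_smul, hk, X_smul_of _ hj],
      fun n hn => ?_⟩
    change extensionX (W n) n _ n hj (k n) = _
    rw [hkn n (by omega), extensionX_extensionGenerator _ _ _ _ hj (by omega) (by omega)]

/-- On the component of degree `i`, the coordinate of index `i` recovers `φᵢ`. -/
theorem exists_tensorToExtensionProduct_of_mem_component (i : ℕ) (t : SkewTensor R p M)
    (ht : t ∈ SkewTensor.component R p M i) :
    ∃ k : (extensionProduct W φ).piece i,
      tensorToExtensionProduct hφ t = of (extensionProduct W φ) i k ∧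
      (show ExtensionPiece (W i) i (degreeGenerators W φ i) i i from k i).1 = φ i t := by
  induction ht using AddSubgroup.closure_induction with
  | zero => exact ⟨0, by simp, (map_zero _).symm⟩
  | add y z _ _ hy hz =>
    obtain ⟨k, hk, hki⟩ := hy
    obtain ⟨l, hl, hli⟩ := hz
    refine ⟨k + l, by rw [map_add, map_add, hk, hl], ?_⟩
    rw [map_add, ← hki, ← hli]
    rfl
  | neg y _ hy =>
    obtain ⟨k, hk, hki⟩ := hy
    refine ⟨-k, by rw [map_neg, map_neg, hk], ?_⟩
    rw [map_neg, ← hki]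
    rfl
  | mem t ht =>
    obtain ⟨r, m, rfl⟩ := ht
    obtain ⟨k, hk, hki⟩ := exists_tensorToExtensionProduct_X_pow_tmul hφ m i
    refine ⟨r • k, ?_, ?_⟩
    · rw [SkewTensor.C_mul_X_pow_tmul, map_smul, hk, C_smul_of]
    · rw [SkewTensor.C_mul_X_pow_tmul, hφ]
      change r • (show ExtensionPiece (W i) i (degreeGenerators W φ i) i i from k i).1 = _
      rw [hki i le_rfl]
      exact congrArg (r • ·) (Pi.single_eq_same _ _)

theorem tensorToExtensionProduct_injective (hinj : ∀ n, Function.Injective (φ n)) :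
    Function.Injective (tensorToExtensionProduct hφ) := by
  rw [injective_iff_map_eq_zero]
  intro t ht
  obtain ⟨d, hd, rfl⟩ := SkewTensor.exists_eq_sum_component t
  choose k hk hki using fun i =>
    exists_tensorToExtensionProduct_of_mem_component hφ i (d i) (hd i)
  refine Finset.sum_eq_zero fun i hi => ?_
  have hcomp := congrArg (component (extensionProduct W φ) i) ht
  rw [Finsupp.sum, map_sum, map_sum, map_zero, Finset.sum_eq_single i] at hcomp
  · rw [hk, component_of] at hcomp
    refine hinj i ?_
    rw [← hki, hcomp, map_zero]
    rfl
  · intro j _ hj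
    rw [hk, component_of_ne (by exact_mod_cast hj)]
  · exact fun h => absurd hi h

end Embedding

/-! ### Special ideals of the product of extensions -/

section SpecialIdeals

variable {G : GradedSkewModule.{u, u} R p}

theorem isXTorsionFree_shift_gradedProduct (hG : IsXTorsionFree R p G.Total)
    (Y : Type u) (s : ℤ) :
    IsXTorsionFree R p ((gradedProduct fun _ : Y => G).shift s).Total := by
  refine IsXTorsionFree.of_jointly_injective (fun _ : Y => hG)
    (fun y => (proj (fun _ : Y => G) y).comp (ofShift _ s)) fun z hz => ?_
  exact (map_eq_zero_iff _ (ofShift_injective s)).1 (eq_zero_of_proj _ _ hz)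

theorem scalarAnnihilator_mem_specialIdeals_of_shift (hG : IsXTorsionFree R p G.Total)
    (Y : Type u) (s : ℤ)
    (z : ((gradedProduct fun _ : Y => G).shift s).Total) :
    scalarAnnihilator (Submodule.span (FrobSkew R p) {z}) ∈ specialIdeals R p G.Total := by
  rw [← scalarAnnihilator_span_map (ofShift_injective s) z,
    scalarAnnihilator_span_of_jointly_injective _ (eq_zero_of_proj (fun _ : Y => G))]
  exact iInf_mem_specialIdeals hG fun y => scalarAnnihilator_mem_specialIdeals hG _

theorem scalarAnnihilator_mem_specialIdeals_of_extension {W : GradedSkewModule.{u, u} R p}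
    {b : ℤ} (hWb : ∀ n < b, Subsingleton (W.piece n)) (hWx : IsXTorsionFree R p W.Total)
    (hW : ∀ z : W.Total, scalarAnnihilator (Submodule.span (FrobSkew R p) {z}) ∈
      specialIdeals R p G.Total) {I : Type u} (g : I → W.piece b) (h : ℕ)
    (z : (extension W b g h).Total) :
    scalarAnnihilator (Submodule.span (FrobSkew R p) {z}) ∈ specialIdeals R p G.Total := by
  obtain ⟨w, hw⟩ := X_pow_smul_mem_range_toExtension W b g h z
  rw [← scalarAnnihilator_span_X_pow_smul (isXTorsionFree_extension W b g h hWb hWx) h z, ← hw,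
    scalarAnnihilator_span_map (toExtension_injective W b g h)]
  exact hW w

variable {Y : ℕ → Type u} {I : ℕ → Type u}
  (g : ∀ n : ℕ, I n → ((gradedProduct fun _ : Y n => G).shift (-(n : ℤ))).piece n)

theorem isXTorsionFree_gradedProduct_extension (hG : G.IsNatGraded)
    (hGx : IsXTorsionFree R p G.Total) :
    IsXTorsionFree R p (gradedProduct fun n : ℕ => extension
      ((gradedProduct fun _ : Y n => G).shift (-(n : ℤ))) n (g n) n).Total :=
  IsXTorsionFree.of_jointly_injective
    (fun n => isXTorsionFree_extension _ _ _ _ (hG.subsingleton_shift_gradedProduct (Y n) n)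
      (isXTorsionFree_shift_gradedProduct hGx _ _))
    (proj _) (eq_zero_of_proj _)

/-- Passing to products, shifts, extensions and submodules creates no annihilators of cyclic
submodules that are not intersections of such annihilators for `G`, and `G` embeds, up to a shift
of degrees, in each of the extensions. -/
theorem specialIdeals_gradedProduct_extension (hG : G.IsNatGraded)
    (hGx : IsXTorsionFree R p G.Total) (hY : ∀ n, Nonempty (Y n)) :
    specialIdeals R p (gradedProduct fun n : ℕ => extension
      ((gradedProduct fun _ : Y n => G).shift (-(n : ℤ))) n (g n) n).Total =
      specialIdeals R p G.Total := by
  have hK := isXTorsionFree_gradedProduct_extension g hG hGx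
  refine (specialIdeals_subset hK hGx fun z => ?_).antisymm
    (specialIdeals_subset hGx hK fun z => ?_)
  · rw [scalarAnnihilator_span_of_jointly_injective _ (eq_zero_of_proj _)]
    exact iInf_mem_specialIdeals hGx fun n =>
      scalarAnnihilator_mem_specialIdeals_of_extension
        (hG.subsingleton_shift_gradedProduct (Y n) n)
        (isXTorsionFree_shift_gradedProduct hGx _ _)
        (scalarAnnihilator_mem_specialIdeals_of_shift hGx _ _) _ _ _
  · have := hY 0
    obtain ⟨w, hw⟩ := ofShift_surjective (A := gradedProduct fun _ : Y 0 => G) (-((0 : ℕ) : ℤ))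
      (diagonal G (Y 0) z)
    rw [← scalarAnnihilator_span_map (diagonal_injective (Y 0)) z, ← hw,
      scalarAnnihilator_span_map (ofShift_injective _),
      ← scalarAnnihilator_span_map (toExtension_injective _ _ (g 0) 0) w,
      ← scalarAnnihilator_span_map (single_injective (fun n : ℕ => extension
        ((gradedProduct fun _ : Y n => G).shift (-(n : ℤ))) n (g n) n) 0)]
    exact scalarAnnihilator_mem_specialIdeals hK _

end SpecialIdeals

end GradedSkewModule

end
end

theorem theorem3p9 {R : Type u} [CommRing R] [IsNoetherianRing R] [IsLocalRing R]
    (p : ℕ) [Fact p.Prime] [CharP R p]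
    (G : GradedSkewModule.{u, u} R p) (hG : G.IsNatGraded)
    (hE : ∃ i : (R ⧸ IsLocalRing.maximalIdeal R) →ₗ[R] G.piece 0, IsInjectiveEnvelope i)
    (M : Type u) [AddCommGroup M] [Module R M]
    (hM : ∀ z : M, ∃ t : ℕ, ∀ r ∈ IsLocalRing.maximalIdeal R ^ t, r • z = 0) :
    ∃ (Y : ℕ → Type u) (I : ℕ → Type u)
      (g : ∀ n : ℕ, I n →
        ((GradedSkewModule.gradedProduct fun _ : Y n => G).shift (-(n : ℤ))).piece n)
      (H : ℕ → GradedSkewModule.{u, u} R p) (K : GradedSkewModule.{u, u} R p)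
      (ν : SkewTensor R p M →ₗ[FrobSkew R p] K.Total),
      (∀ n, Nonempty (Y n)) ∧ (∀ n, Nonempty (I n)) ∧
      (∀ n : ℕ, H n = GradedSkewModule.extension
        ((GradedSkewModule.gradedProduct fun _ : Y n => G).shift (-(n : ℤ))) n (g n) n) ∧
      (∀ n, (H n).IsNatGraded) ∧
      K = GradedSkewModule.gradedProduct H ∧
      Function.Injective ν ∧
      (∀ i : ℕ, ∀ t ∈ SkewTensor.component R p M i,
        ∃ k : K.piece i, ν t = GradedSkewModule.Total.of K i k) ∧
      (IsXTorsionFree R p G.Total → (specialIdeals R p G.Total).Finite →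
        ∃ b : Ideal R,
          IsLeast {c | c ∈ specialIdeals R p G.Total ∧ 0 < c.height} b ∧
          IsXTorsionFree R p K.Total ∧
          specialIdeals R p K.Total = specialIdeals R p G.Total ∧
          IsIdealTestable R p (SkewTensor R p M) b) := by
  -- The degree `n` component of the shift is `G.piece (n + -n)`, not syntactically `G.piece 0`.
  have hE' (k : ℤ) (hk : k = 0) :
      ∃ i : (R ⧸ IsLocalRing.maximalIdeal R) →ₗ[R] G.piece k, IsInjectiveEnvelope i := by
    subst hk
    exact hE
  choose Y φ hY hφ hinj using fun n : ℕ =>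
    exists_injective_pi (hE' ((n : ℤ) + -n) (add_neg_cancel _)).choose_spec (SkewTensor R p M)
  let W (n : ℕ) : GradedSkewModule.{u, u} R p :=
    (GradedSkewModule.gradedProduct fun _ : Y n => G).shift (-(n : ℤ))
  have hφ' : ∀ (n : ℕ) (r : R) (t : SkewTensor R p M),
      (show SkewTensor R p M →+ (W n).piece n from φ n) (FrobSkew.C p r • t) =
        r • (show SkewTensor R p M →+ (W n).piece n from φ n) t := hφ
  let g (n : ℕ) : M → (W n).piece n := GradedSkewModule.degreeGenerators W φ n
  have hν := GradedSkewModule.tensorToExtensionProduct_injective hφ' hinj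
  refine ⟨Y, fun _ => M, g, _, _, GradedSkewModule.tensorToExtensionProduct hφ', hY,
    fun _ => ⟨0⟩, fun n => rfl, fun n => ?_, rfl, hν, fun i t ht => ?_, fun hGx hfin => ?_⟩
  · exact GradedSkewModule.isNatGraded_extension _ _ _ _
      (hG.subsingleton_shift_gradedProduct (Y n) n) (by omega) le_rfl le_rfl
  · obtain ⟨k, hk, -⟩ :=
      GradedSkewModule.exists_tensorToExtensionProduct_of_mem_component hφ' i t ht
    exact ⟨k, hk⟩
  · obtain ⟨b, hb⟩ := exists_isLeast_specialIdeals hGx hfin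
    have hKx := GradedSkewModule.isXTorsionFree_gradedProduct_extension g hG hGx
    have hKI := GradedSkewModule.specialIdeals_gradedProduct_extension g hG hGx hY
    exact ⟨b, hb, hKx, hKI, (isIdealTestable_of_isLeast hKx (hKI ▸ hb)).of_injective hν⟩
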